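/- Let $G$ be a group (of arbitrary cardinality). For $w\in\mathbb Z*G=\langle t\rangle*G$ and $g\in G$ let $w(g)\in G$ be the image of $w$ under the homomorphism $\mathbb Z*G\to G$ that is the identity on $G$ and sends $t$ to $g$. Call $w$ a mixed identity for $G$ if $w(g)=1$ for all $g\in G$, and call $G$ mixed-identity-free (MIF) if $w=1$ is the only mixed identity for $G$. Let $LG$ be the group von Neumann algebra of $G$, i.e. the double commutant in $B(\ell^2(G))$ of the left-regular representation $(\lambda_g f)(h)=f(g^{-1}h)$, with its canonical trace $\tau(x)=\langle x\delta_1,\delta_1\rangle$ and $2$-norm $\|x\|_2=\tau(x^*x)^{1/2}$. Let $\mathrm U(LG)$ be its unitary group and let $\mathrm{PU}(LG)=\mathrm U(LG)/(S^1\cdot 1)$ be its projective unitary group, with the topology of the metric $d([u],[v])=\bar\ell(u^{-1}v)$, where $\bar\ell(u)=\inf_{|c|=1}\|c\cdot 1-u\|_2$. The map $g\mapsto[\lambda_g]$ is an injective homomorphism, by which $G$ is viewed as a subgroup of $\mathrm{PU}(LG)$. A subgroup of $\mathrm{PU}(LG)$ is discrete if its subspace topology is discrete. **Theorem.** If $G$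 is MIF, then there is a subgroup $\Gamma$ of $\mathrm{PU}(LG)$ that contains $G$ and is maximal, with respect to inclusion, among all discrete subgroups of $\mathrm{PU}(LG)$. -/

import Mathlib

/-! ## Mixed identities -/

/-- The evaluation homomorphism `ℤ ∗ G → G` which is the identity on `G` and sends the generator
`t` of `ℤ` to `g`. -/
def mixedEval {G : Type*} [Group G] (g : G) : Monoid.Coprod (Multiplicative ℤ) G →* G :=
  Monoid.Coprod.lift (zpowersHom G g) (MonoidHom.id G)

/-- `w ∈ ℤ ∗ G` is a mixed identity for `G` if it evaluates to `1` whenever any element of `G` is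
substituted for the variable `t`. -/
def IsMixedIdentity {G : Type*} [Group G] (w : Monoid.Coprod (Multiplicative ℤ) G) : Prop :=
  ∀ g : G, mixedEval g w = 1

/-- `G` is mixed-identity-free: it satisfies no non-trivial mixed identity. -/
def IsMIF (G : Type*) [Group G] : Prop :=
  ∀ w : Monoid.Coprod (Multiplicative ℤ) G, IsMixedIdentity w → w = 1

/-! ## The group von Neumann algebra -/

/-- The Hilbert space `ℓ²(G)`. -/
abbrev EllTwo (G : Type*) : Type _ := lp (fun _ : G => ℂ) 2

/-- The unitary operator on `ℓ²(G)` given by `f ↦ f ∘ e`, for a bijection `e` of `G`. -/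
noncomputable def EllTwo.permute {G : Type*} (e : G ≃ G) : EllTwo G →ₗᵢ[ℂ] EllTwo G where
  toFun f := ⟨fun h => f (e h), by
    have h2 : 0 < (2 : ENNReal).toReal := by norm_num
    exact (memℓp_gen_iff h2).2 (e.summable_iff.2 ((memℓp_gen_iff h2).1 (lp.memℓp f)))⟩
  map_add' _ _ := rfl
  map_smul' _ _ := rfl
  norm_map' f := by
    have h2 : 0 < (2 : ENNReal).toReal := by norm_num
    rw [lp.norm_eq_tsum_rpow h2, lp.norm_eq_tsum_rpow h2]
    congr 1
    exact e.tsum_eq (fun h => ‖f h‖ ^ (2 : ENNReal).toReal)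

theorem EllTwo.permute_apply {G : Type*} (e : G ≃ G) (f : EllTwo G) (h : G) :
    EllTwo.permute e f h = f (e h) := rfl

theorem EllTwo.adjoint_permute {G : Type*} (e : G ≃ G) :
    star (EllTwo.permute e).toContinuousLinearMap =
      (EllTwo.permute e.symm).toContinuousLinearMap := by
  rw [ContinuousLinearMap.star_eq_adjoint]
  refine ((ContinuousLinearMap.eq_adjoint_iff _ _).2 fun x y => ?_).symm
  rw [lp.inner_eq_tsum, lp.inner_eq_tsum, ← e.tsum_eq]
  refine tsum_congr fun h => ?_
  simp [EllTwo.permute_apply]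

/-- The left-regular representation `(λ_g f)(h) = f(g⁻¹ h)` on `ℓ²(G)`. -/
noncomputable def leftRegular {G : Type*} [Group G] (g : G) : EllTwo G →L[ℂ] EllTwo G :=
  (EllTwo.permute (Equiv.mulLeft g⁻¹)).toContinuousLinearMap

theorem leftRegular_apply {G : Type*} [Group G] (g : G) (f : EllTwo G) (h : G) :
    leftRegular g f h = f (g⁻¹ * h) := rfl

theorem leftRegular_one {G : Type*} [Group G] : leftRegular (1 : G) = 1 := by
  ext f h
  simp [leftRegular_apply]

theorem leftRegular_mul {G : Type*} [Group G] (a b : G) :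
    leftRegular (a * b) = leftRegular a * leftRegular b := by
  ext f h
  simp [leftRegular_apply, mul_assoc]

theorem star_leftRegular {G : Type*} [Group G] (g : G) :
    star (leftRegular g) = leftRegular g⁻¹ := by
  rw [leftRegular, EllTwo.adjoint_permute]
  ext f h
  simp [leftRegular_apply, EllTwo.permute_apply]

/-- The group von Neumann algebra `LG`: the double commutant of the left-regular representation
in the bounded operators on `ℓ²(G)`. -/
noncomputable def groupVN (G : Type*) [Group G] : VonNeumannAlgebra (EllTwo G) where
  toStarSubalgebra := StarSubalgebra.centralizer ℂ
    (StarSubalgebra.centralizer ℂ (Set.range (leftRegular (G := G))) :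
      Set (EllTwo G →L[ℂ] EllTwo G))
  centralizer_centralizer' := by
    change Set.centralizer (Set.centralizer (SetLike.coe (StarSubalgebra.centralizer ℂ _))) =
      SetLike.coe (StarSubalgebra.centralizer ℂ _)
    rw [StarSubalgebra.coe_centralizer, Set.centralizer_centralizer_centralizer]

/-- `LG` as a *-algebra in its own right. -/
abbrev GroupVN (G : Type*) [Group G] : Type _ := (groupVN G).toStarSubalgebra

theorem leftRegular_mem_groupVN {G : Type*} [Group G] (g : G) :
    leftRegular g ∈ (groupVN G).toStarSubalgebra := by
  change leftRegular g ∈ StarSubalgebra.centralizer ℂ _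
  rw [StarSubalgebra.mem_centralizer_iff]
  intro x hx
  have hx' := (StarSubalgebra.mem_centralizer_iff ℂ).1 hx
  have h1 := hx' _ (Set.mem_range_self g)
  have h2 := ((StarSubalgebra.mem_centralizer_iff ℂ).1 (star_mem hx)) _ (Set.mem_range_self g)
  exact ⟨h1.1.symm, h2.1.symm⟩

open Classical in
/-- The canonical unit vector `δ_1 ∈ ℓ²(G)`. -/
noncomputable def deltaOne (G : Type*) [Group G] : EllTwo G := lp.single 2 (1 : G) (1 : ℂ)

theorem deltaOne_apply_one {G : Type*} [Group G] : deltaOne G 1 = 1 := by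
  simp [deltaOne]

theorem deltaOne_apply_ne {G : Type*} [Group G] {g : G} (hg : g ≠ 1) : deltaOne G g = 0 := by
  classical
  exact lp.single_apply_ne _ _ _ hg

/-- The canonical trace `τ(x) = ⟨δ_1, x δ_1⟩` on `LG`. -/
noncomputable def vnTrace {G : Type*} [Group G] (x : GroupVN G) : ℂ :=
  inner ℂ (deltaOne G) ((x : EllTwo G →L[ℂ] EllTwo G) (deltaOne G))

/-- The `2`-norm `‖x‖₂ = τ(x* x)^{1/2}` on `LG`. -/
noncomputable def twoNorm {G : Type*} [Group G] (x : GroupVN G) : ℝ :=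
  Real.sqrt (vnTrace (star x * x)).re

theorem twoNorm_eq {G : Type*} [Group G] (x : GroupVN G) :
    twoNorm x = ‖(x : EllTwo G →L[ℂ] EllTwo G) (deltaOne G)‖ := by
  have h : vnTrace (star x * x) = inner ℂ ((x : EllTwo G →L[ℂ] EllTwo G) (deltaOne G))
      ((x : EllTwo G →L[ℂ] EllTwo G) (deltaOne G)) := by
    rw [vnTrace, ← ContinuousLinearMap.adjoint_inner_right]
    rfl
  rw [twoNorm, h, norm_eq_sqrt_re_inner (𝕜 := ℂ)]
  rfl

/-- The vector `δ_1` is separating for `LG`. -/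
theorem eq_zero_of_twoNorm_eq_zero {G : Type*} [Group G] (x : GroupVN G) (hx : twoNorm x = 0) :
    x = 0 := by
  classical
  rw [twoNorm_eq, norm_eq_zero] at hx
  obtain ⟨x, hmem⟩ := x
  change x (deltaOne G) = 0 at hx
  ext1
  change x = 0
  let R : G → EllTwo G →L[ℂ] EllTwo G := fun g =>
    (EllTwo.permute (Equiv.mulRight g)).toContinuousLinearMap
  have hR : ∀ g, R g ∈ StarSubalgebra.centralizer ℂ (Set.range (leftRegular (G := G))) := by
    intro g
    rw [StarSubalgebra.mem_centralizer_iff]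
    have key : ∀ k : G, leftRegular k * R g = R g * leftRegular k := by
      intro k
      ext f h
      change f (k⁻¹ * h * g) = f (k⁻¹ * (h * g))
      rw [mul_assoc]
    rintro _ ⟨k, rfl⟩
    refine ⟨key k, ?_⟩
    rw [star_leftRegular]
    exact key _
  have hcomm : ∀ g, R g * x = x * R g := fun g =>
    ((StarSubalgebra.mem_centralizer_iff ℂ).1 hmem _ (hR g)).1
  have hsingle : ∀ g : G, x (lp.single 2 g 1) = 0 := by
    intro g
    have h1 : lp.single 2 g (1 : ℂ) = R g⁻¹ (deltaOne G) := by
      ext h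
      change (lp.single 2 g (1 : ℂ) : EllTwo G) h = deltaOne G (h * g⁻¹)
      by_cases hh : h = g
      · subst hh
        rw [mul_inv_cancel, deltaOne_apply_one, lp.single_apply_self]
      · rw [lp.single_apply_ne _ _ _ hh, deltaOne_apply_ne]
        rwa [Ne, mul_inv_eq_one]
    have h2 := congrArg (fun T : EllTwo G →L[ℂ] EllTwo G => T (deltaOne G)) (hcomm g⁻¹)
    change R g⁻¹ (x (deltaOne G)) = x (R g⁻¹ (deltaOne G)) at h2
    rw [h1, ← h2, hx, map_zero]
  refine ContinuousLinearMap.ext fun f => ?_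
  have hs := (lp.hasSum_single (by norm_num : (2 : ENNReal) ≠ ⊤) f).mapL x
  have hz : ∀ g : G, x (lp.single 2 g (f g)) = 0 := by
    intro g
    have : (lp.single 2 g (f g) : EllTwo G) = f g • lp.single 2 g (1 : ℂ) := by
      rw [← lp.single_smul, smul_eq_mul, mul_one]
    rw [this, map_smul, hsingle, smul_zero]
  simp only [hz] at hs
  exact hs.unique hasSum_zero

/-! ## The unitary group and its length functions -/

/-- The unitary group `U(LG)`. -/
abbrev UnitaryVN (G : Type*) [Group G] : Type _ := unitary (GroupVN G)

/-- The inclusion of the circle group `S¹` into `U(LG)` as scalar multiples of `1`. -/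
noncomputable def circleToUnitary (G : Type*) [Group G] : Circle →* UnitaryVN G where
  toFun c := ⟨(c : ℂ) • 1, by
    rw [Unitary.mem_iff]
    constructor <;>
    · simp only [star_smul, star_one, smul_mul_smul_comm, mul_one]
      rw [RCLike.star_def]
      first
        | rw [Complex.conj_mul', Circle.norm_coe]
        | rw [Complex.mul_conj', Circle.norm_coe]
      simp⟩
  map_one' := by ext1; simp
  map_mul' a b := by ext1; simp [smul_smul, mul_comm]

theorem circleToUnitary_coe {G : Type*} [Group G] (c : Circle) :
    ((circleToUnitary G c : UnitaryVN G) : GroupVN G) = (c : ℂ) • 1 := rfl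

instance circleToUnitary_range_normal (G : Type*) [Group G] :
    (circleToUnitary G).range.Normal where
  conj_mem := by
    rintro _ ⟨c, rfl⟩ u
    refine ⟨c, ?_⟩
    rw [eq_mul_inv_iff_mul_eq]
    ext1
    simp [circleToUnitary_coe]

/-- The left-regular representation as a homomorphism `G → U(LG)`. -/
noncomputable def leftRegularUnitary (G : Type*) [Group G] : G →* UnitaryVN G where
  toFun g := ⟨⟨leftRegular g, leftRegular_mem_groupVN g⟩, by
    rw [Unitary.mem_iff]
    constructor <;> ext1
    · change star (leftRegular g) * leftRegular g = 1
      rw [star_leftRegular, ← leftRegular_mul, inv_mul_cancel, leftRegular_one]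
    · change leftRegular g * star (leftRegular g) = 1
      rw [star_leftRegular, ← leftRegular_mul, mul_inv_cancel, leftRegular_one]⟩
  map_one' := by
    ext1; ext1
    exact leftRegular_one
  map_mul' a b := by
    ext1; ext1
    exact leftRegular_mul a b

/-- The projective length `ℓ̄(u) = inf_{|c| = 1} ‖c - u‖₂` on `U(LG)`. -/
noncomputable def projLength {G : Type*} [Group G] (u : UnitaryVN G) : ℝ :=
  ⨅ c : Circle, twoNorm ((c : ℂ) • 1 - (u : GroupVN G))

theorem projLength_le {G : Type*} [Group G] (u : UnitaryVN G) (c : Circle) :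
    projLength u ≤ twoNorm ((c : ℂ) • 1 - (u : GroupVN G)) :=
  ciInf_le ⟨0, by rintro _ ⟨c, rfl⟩; exact Real.sqrt_nonneg _⟩ c

/-- The infimum in the definition of the projective length is attained. -/
theorem exists_projLength_eq {G : Type*} [Group G] (u : UnitaryVN G) :
    ∃ c : Circle, projLength u = twoNorm ((c : ℂ) • 1 - (u : GroupVN G)) := by
  have hcont : Continuous fun c : Circle => twoNorm ((c : ℂ) • 1 - (u : GroupVN G)) := by
    have : (fun c : Circle => twoNorm ((c : ℂ) • 1 - (u : GroupVN G))) = fun c : Circle =>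
        ‖(c : ℂ) • deltaOne G - ((u : GroupVN G) : EllTwo G →L[ℂ] EllTwo G) (deltaOne G)‖ := by
      funext c
      rw [twoNorm_eq]
      rfl
    rw [this]
    fun_prop
  obtain ⟨c, -, hc⟩ := isCompact_univ.exists_isMinOn Set.univ_nonempty hcont.continuousOn
  refine ⟨c, le_antisymm (projLength_le u c) (le_ciInf fun d => ?_)⟩
  exact hc (Set.mem_univ d)

theorem norm_unitaryVN_apply {G : Type*} [Group G] (u : UnitaryVN G) (f : EllTwo G) :
    ‖((u : GroupVN G) : EllTwo G →L[ℂ] EllTwo G) f‖ = ‖f‖ := by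
  have h : ((u : GroupVN G) : EllTwo G →L[ℂ] EllTwo G) ∈ unitary (EllTwo G →L[ℂ] EllTwo G) := by
    rw [Unitary.mem_iff]
    exact ⟨congrArg Subtype.val (Unitary.coe_star_mul_self u),
      congrArg Subtype.val (Unitary.coe_mul_star_self u)⟩
  exact Unitary.norm_map ⟨_, h⟩ f

theorem twoNorm_unitary_mul {G : Type*} [Group G] (u : UnitaryVN G) (x : GroupVN G) :
    twoNorm ((u : GroupVN G) * x) = twoNorm x := by
  rw [twoNorm_eq, twoNorm_eq]
  exact norm_unitaryVN_apply u _

theorem twoNorm_sub_comm {G : Type*} [Group G] (x y : GroupVN G) :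
    twoNorm (x - y) = twoNorm (y - x) := by
  rw [twoNorm_eq, twoNorm_eq, ← norm_neg]
  congr 1
  change -((x : EllTwo G →L[ℂ] EllTwo G) (deltaOne G) - (y : EllTwo G →L[ℂ] EllTwo G) (deltaOne G))
    = (y : EllTwo G →L[ℂ] EllTwo G) (deltaOne G) - (x : EllTwo G →L[ℂ] EllTwo G) (deltaOne G)
  rw [neg_sub]

theorem twoNorm_add_le {G : Type*} [Group G] (x y : GroupVN G) :
    twoNorm (x + y) ≤ twoNorm x + twoNorm y := by
  rw [twoNorm_eq, twoNorm_eq, twoNorm_eq]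
  exact norm_add_le _ _

theorem projLength_inv {G : Type*} [Group G] (u : UnitaryVN G) :
    projLength u⁻¹ = projLength u := by
  have key : ∀ v : UnitaryVN G, projLength v⁻¹ ≤ projLength v := by
    intro v
    obtain ⟨c, hc⟩ := exists_projLength_eq v
    refine (projLength_le v⁻¹ c⁻¹).trans_eq ?_
    rw [hc, ← twoNorm_unitary_mul (circleToUnitary G c * v), twoNorm_sub_comm]
    congr 1
    have h1 : ((c⁻¹ : Circle) : ℂ) • (1 : GroupVN G) = ((circleToUnitary G c)⁻¹ : UnitaryVN G) := by
      rw [← map_inv]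
      rfl
    rw [h1, mul_sub, ← circleToUnitary_coe (G := G) c]
    have h2 : circleToUnitary G c * v = v * circleToUnitary G c := by
      ext1
      simp [circleToUnitary_coe]
    rw [← Submonoid.coe_mul, ← Submonoid.coe_mul, mul_inv_cancel_right, h2, mul_inv_cancel_right]
  refine le_antisymm (key u) ?_
  simpa using key u⁻¹

theorem projLength_mul_le {G : Type*} [Group G] (u v : UnitaryVN G) :
    projLength (u * v) ≤ projLength u + projLength v := by
  obtain ⟨c, hc⟩ := exists_projLength_eq u
  obtain ⟨d, hd⟩ := exists_projLength_eq v
  refine (projLength_le (u * v) (d * c)).trans ?_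
  have h : ((d * c : Circle) : ℂ) • (1 : GroupVN G) - ((u * v : UnitaryVN G) : GroupVN G) =
      ((circleToUnitary G d : UnitaryVN G) : GroupVN G) * ((c : ℂ) • 1 - (u : GroupVN G)) +
        (u : GroupVN G) * ((d : ℂ) • 1 - (v : GroupVN G)) := by
    rw [circleToUnitary_coe]
    simp only [Submonoid.coe_mul, Circle.coe_mul, mul_sub, smul_mul_assoc, one_mul,
      mul_smul_comm, mul_one, smul_smul, mul_comm (d : ℂ)]
    abel
  rw [h, hc, hd, ← twoNorm_unitary_mul (circleToUnitary G d) ((c : ℂ) • 1 - (u : GroupVN G)),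
    ← twoNorm_unitary_mul u ((d : ℂ) • 1 - (v : GroupVN G))]
  exact twoNorm_add_le _ _

theorem projLength_circle {G : Type*} [Group G] (c : Circle) :
    projLength (circleToUnitary G c) = 0 := by
  refine le_antisymm ((projLength_le _ c).trans_eq ?_) (Real.iInf_nonneg fun _ => Real.sqrt_nonneg _)
  rw [circleToUnitary_coe, sub_self, twoNorm_eq]
  simp

theorem projLength_eq_zero_iff {G : Type*} [Group G] (u : UnitaryVN G) :
    projLength u = 0 ↔ u ∈ (circleToUnitary G).range := by
  constructor
  · intro h
    obtain ⟨c, hc⟩ := exists_projLength_eq u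
    refine ⟨c, ?_⟩
    ext1
    exact sub_eq_zero.1 (eq_zero_of_twoNorm_eq_zero _ (hc.symm.trans h))
  · rintro ⟨c, rfl⟩
    exact projLength_circle c

/-! ## The projective unitary group -/

/-- The projective unitary group `PU(LG) = U(LG) / S¹`. -/
def ProjUnitaryVN (G : Type*) [Group G] : Type _ := UnitaryVN G ⧸ (circleToUnitary G).range

noncomputable instance ProjUnitaryVN.instGroup (G : Type*) [Group G] : Group (ProjUnitaryVN G) :=
  QuotientGroup.Quotient.group (circleToUnitary G).range

/-- The quotient map `U(LG) → PU(LG)`. -/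
noncomputable def ProjUnitaryVN.mk (G : Type*) [Group G] : UnitaryVN G →* ProjUnitaryVN G :=
  QuotientGroup.mk' (circleToUnitary G).range

theorem ProjUnitaryVN.mk_surjective {G : Type*} [Group G] :
    Function.Surjective (ProjUnitaryVN.mk G) :=
  QuotientGroup.mk'_surjective _

theorem ProjUnitaryVN.mk_eq_one_iff {G : Type*} [Group G] (u : UnitaryVN G) :
    ProjUnitaryVN.mk G u = 1 ↔ u ∈ (circleToUnitary G).range :=
  QuotientGroup.eq_one_iff u

/-- The projective length on `PU(LG)`. -/
noncomputable def ProjUnitaryVN.length {G : Type*} [Group G] (x : ProjUnitaryVN G) : ℝ :=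
  Quotient.lift (s := QuotientGroup.leftRel (circleToUnitary G).range) projLength (by
    have key : ∀ a b : UnitaryVN G, a⁻¹ * b ∈ (circleToUnitary G).range →
        projLength b ≤ projLength a := by
      intro a b h
      have := projLength_mul_le a (a⁻¹ * b)
      rwa [(projLength_eq_zero_iff _).2 h, mul_inv_cancel_left, add_zero] at this
    intro a b h
    have h1 := QuotientGroup.leftRel_apply.1 h
    refine le_antisymm (key b a ?_) (key a b h1)
    simpa using inv_mem h1) x

theorem ProjUnitaryVN.length_mk {G : Type*} [Group G] (u : UnitaryVN G) :
    (ProjUnitaryVN.mk G u).length = projLength u := rfl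

/-- The metric on `PU(LG)` given by the projective length, `d(x, y) = ℓ̄(x⁻¹ y)`; its topology is
the one used on `PU(LG)` throughout. -/
noncomputable instance ProjUnitaryVN.instMetricSpace (G : Type*) [Group G] :
    MetricSpace (ProjUnitaryVN G) where
  dist x y := (x⁻¹ * y).length
  dist_self x := by
    rw [inv_mul_cancel, ← map_one (ProjUnitaryVN.mk G), length_mk, projLength_eq_zero_iff]
    exact one_mem _
  dist_comm x y := by
    obtain ⟨u, rfl⟩ := mk_surjective x
    obtain ⟨v, rfl⟩ := mk_surjective y
    rw [← map_inv, ← map_inv, ← map_mul, ← map_mul, length_mk, length_mk, ← projLength_inv]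
    simp
  dist_triangle x y z := by
    obtain ⟨u, rfl⟩ := mk_surjective x
    obtain ⟨v, rfl⟩ := mk_surjective y
    obtain ⟨w, rfl⟩ := mk_surjective z
    simp only [← map_inv, ← map_mul, length_mk]
    simpa [mul_assoc] using projLength_mul_le (u⁻¹ * v) (v⁻¹ * w)
  eq_of_dist_eq_zero {x y} h := by
    obtain ⟨u, rfl⟩ := mk_surjective x
    obtain ⟨v, rfl⟩ := mk_surjective y
    change ((mk G u)⁻¹ * mk G v).length = 0 at h
    rw [← map_inv, ← map_mul, length_mk, projLength_eq_zero_iff, ← mk_eq_one_iff, map_mul,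
      map_inv, inv_mul_eq_one] at h
    exact h

theorem ProjUnitaryVN.dist_def {G : Type*} [Group G] (x y : ProjUnitaryVN G) :
    dist x y = (x⁻¹ * y).length := rfl

/-- The natural map `G → PU(LG)` induced by the left-regular representation. -/
noncomputable def toProjUnitaryVN (G : Type*) [Group G] : G →* ProjUnitaryVN G :=
  (ProjUnitaryVN.mk G).comp (leftRegularUnitary G)

theorem toProjUnitaryVN_injective (G : Type*) [Group G] :
    Function.Injective (toProjUnitaryVN G) := by
  rw [injective_iff_map_eq_one]
  intro g hg
  obtain ⟨c, hc⟩ := (ProjUnitaryVN.mk_eq_one_iff _).1 hg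
  by_contra hne
  have h1 := congrArg (fun u : UnitaryVN G =>
    ((u : GroupVN G) : EllTwo G →L[ℂ] EllTwo G) (deltaOne G) 1) hc
  change (c : ℂ) * deltaOne G 1 = deltaOne G (g⁻¹ * 1) at h1
  rw [deltaOne_apply_one, deltaOne_apply_ne (by simpa using hne), mul_one] at h1
  exact Circle.coe_ne_zero c h1

/-!
For unitaries `u`, `v` of a tracial von Neumann algebra which are free and have the same trace, the
commutator has trace `2 |τ(u)|² - |τ(u)|⁴ = 1 - (1 - |τ(u)|²)²`. As the projective length satisfies
`ℓ̄(u)² = 2 - 2 |τ(u)|`, the commutator is non-scalar if `u` is, and its length is of the order of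
`ℓ̄(u)²`. So if `u` is close to the scalars, then passing to the commutator contracts the length
without making it vanish.

In a mixed-identity-free group `G`, every `u ∈ U(LG)` becomes approximately free from a conjugate
`λ_g u λ_g⁻¹` with `g ∈ G`. First, finitely many non-trivial mixed words can be made non-trivial by
one substitution, because in `ℤ ∗ G` any two non-trivial elements have conjugates that do not
commute (`exists_word_dominating`, `IsMIF.exists_forall_mul_conj_eq_iff`). Secondly, the trace of
the commutator is the inner product of `(λ_g u λ_g⁻¹) u δ₁` and `u (λ_g u λ_g⁻¹) δ₁`; it is computed
from truncated Fourier series of `u`, where one truncation is chosen after the other in order to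
avoid any control of operator norms
(`GroupVN.inner_conj_trunc_mul`, `GroupVN.exists_norm_coeff_commutator_sub_lt`).

Hence a subgroup of `PU(LG)` containing `G` and a non-trivial element of length less than `1 / 4`
has non-trivial elements of arbitrarily small length, so all discrete subgroups containing `G` have
the common gap `1 / 4` (`ProjUnitaryVN.le_length_of_discrete`). The gap passes to unions of chains,
and Zorn's lemma applies, starting from `G` itself.
-/

open scoped ComplexConjugate InnerProductSpace

/-! ### Reduced words in free products of two factors -/

theorem Monoid.CoprodI.NeWord.prod_ne_one {ι : Type*} {M : ι → Type*} [∀ i, Group (M i)] {i j : ι}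
    (w : Monoid.CoprodI.NeWord M i j) : w.prod ≠ 1 := by
  classical
  intro h
  refine w.toList_ne_nil (congrArg Monoid.CoprodI.Word.toList
    (Monoid.CoprodI.Word.equiv.symm.injective (a₁ := w.toWord) (a₂ := .empty) ?_))
  exact h.trans Monoid.CoprodI.Word.prod_empty.symm

/-- In a free product of two factors, the first of which is infinite, every non-trivial
element is conjugate to one whose reduced word starts and ends in the first factor. -/
theorem Monoid.CoprodI.exists_neWord_prod_eq_conj {M : Bool → Type*} [∀ i, Group (M i)]
    [Infinite (M false)] {w : Monoid.CoprodI M} (hw : w ≠ 1) :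
    ∃ (c : Monoid.CoprodI M) (v : Monoid.CoprodI.NeWord M false false), v.prod = c * w * c⁻¹ := by
  classical
  have key : ∀ {i j : Bool} (v : NeWord M i j), j = true →
      ∃ (c : CoprodI M) (v' : NeWord M false false), v'.prod = c * v.prod * c⁻¹ := by
    rintro (_ | _) _ v rfl
    -- Here `v` starts in the first factor; the letter `x` must not cancel its head.
    · obtain ⟨x, hx⟩ := Infinite.exists_notMem_finset {1, v.head⁻¹}
      simp only [Finset.mem_insert, Finset.mem_singleton, not_or] at hx
      exact ⟨of x, .append (v.mulHead x (by rw [Ne, mul_eq_one_iff_eq_inv]; exact hx.2))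
        (by decide) (.singleton x⁻¹ (inv_ne_one.2 hx.1)), by simp [mul_assoc]⟩
    · obtain ⟨x, hx⟩ := exists_ne (1 : M false)
      exact ⟨of x, .append (.append (.singleton x hx) (by decide) v) (by decide)
        (.singleton x⁻¹ (inv_ne_one.2 hx)), by simp [mul_assoc]⟩
  have hword : Word.equiv w ≠ .empty := fun h => hw (by
    rw [← Word.equiv.symm_apply_apply w, h]; exact Word.prod_empty)
  obtain ⟨i, j, v, hv⟩ := NeWord.of_word _ hword
  obtain rfl : v.prod = w := by
    rw [NeWord.prod, hv]; exact Word.equiv.symm_apply_apply w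
  match i, j, v with
  | _, true, v => exact key v rfl
  -- The inverse of `v` ends in the second factor.
  | true, false, v =>
    obtain ⟨c, v', h⟩ := key v.inv rfl
    exact ⟨c, v'.inv, by simp [h, mul_assoc]⟩
  | false, false, v => exact ⟨1, v, by simp⟩

/-- Two non-trivial elements of a free product have conjugates which do not commute. -/
theorem Monoid.CoprodI.exists_not_commute_conj {M : Bool → Type*} [∀ i, Group (M i)]
    [Infinite (M false)] [Nontrivial (M true)] {w₁ w₂ : Monoid.CoprodI M}
    (h₁ : w₁ ≠ 1) (h₂ : w₂ ≠ 1) :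
    ∃ y z : Monoid.CoprodI M, ¬ Commute (y * w₁ * y⁻¹) (z * w₂ * z⁻¹) := by
  obtain ⟨y, v₁, e₁⟩ := exists_neWord_prod_eq_conj h₁
  obtain ⟨z, v₂, e₂⟩ := exists_neWord_prod_eq_conj h₂
  obtain ⟨s, hs⟩ := exists_ne (1 : M true)
  -- With `s` in the second factor, `v₁ s v₂ s⁻¹ v₁⁻¹ s v₂⁻¹ s⁻¹` is reduced as it stands.
  let S : NeWord M true true := .singleton s hs
  let V : NeWord M true true := .append (.append S (by decide) v₂) (by decide) S.inv
  let W : NeWord M false true :=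
    .append (.append v₁ (by decide) V) (by decide) (.append v₁.inv (by decide) V.inv)
  refine ⟨y, of s * z, ?_⟩
  have hV : V.prod = of s * z * w₂ * (of s * z)⁻¹ := by
    simp only [V, S, NeWord.append_prod, NeWord.inv_prod, NeWord.prod_singleton, e₂]
    group
  intro hcomm
  rw [← e₁, ← hV] at hcomm
  refine W.prod_ne_one ?_
  simp only [W, NeWord.append_prod, NeWord.inv_prod]
  rw [hcomm.eq]
  group

/-! ### Mixed words and substitutions in general position -/

/-- The two factors of `ℤ ∗ G` as a family of groups in one universe: `ℤ` is the factor at `false`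
and `G` the one at `true`. This gives access to reduced words, which Mathlib has for
`Monoid.CoprodI` only. -/
def MixedFactor (G : Type*) : Bool → Type _
  | false => ULift (Multiplicative ℤ)
  | true => G

instance MixedFactor.instGroup (G : Type*) [Group G] : ∀ b, Group (MixedFactor G b)
  | false => inferInstanceAs (Group (ULift (Multiplicative ℤ)))
  | true => inferInstanceAs (Group G)

instance MixedFactor.infinite_false (G : Type*) : Infinite (MixedFactor G false) :=
  inferInstanceAs (Infinite (ULift (Multiplicative ℤ)))

instance MixedFactor.nontrivial_true (G : Type*) [Nontrivial G] :
    Nontrivial (MixedFactor G true) :=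
  inferInstanceAs (Nontrivial G)

/-- The letter `t` generating the factor `ℤ` of `ℤ ∗ G`. -/
def MixedFactor.gen (G : Type*) : MixedFactor G false :=
  ULift.up (Multiplicative.ofAdd 1)

theorem MixedFactor.gen_ne_one (G : Type*) [Group G] : MixedFactor.gen G ≠ 1 := fun h =>
  one_ne_zero (congrArg (fun x : ULift (Multiplicative ℤ) => x.down.toAdd) h)

/-- `ℤ ∗ G` as a binary free product agrees with `ℤ ∗ G` as an indexed free product. -/
def mixedEquiv (G : Type*) [Group G] :
    Monoid.Coprod (Multiplicative ℤ) G ≃* Monoid.CoprodI (MixedFactor G) :=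
  MonoidHom.toMulEquiv
    (Monoid.Coprod.lift
      ((Monoid.CoprodI.of (M := MixedFactor G) (i := false)).comp
        (MulEquiv.ulift.symm : Multiplicative ℤ ≃* ULift (Multiplicative ℤ)).toMonoidHom)
      (Monoid.CoprodI.of (M := MixedFactor G) (i := true)))
    (Monoid.CoprodI.lift fun b => match b with
      | false => (Monoid.Coprod.inl : Multiplicative ℤ →* Monoid.Coprod (Multiplicative ℤ) G).comp
          (MulEquiv.ulift : ULift (Multiplicative ℤ) ≃* Multiplicative ℤ).toMonoidHom
      | true => Monoid.Coprod.inr)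
    (by
      apply Monoid.Coprod.hom_ext <;> ext
      · simp; rfl
      · simp; rfl)
    (by
      refine Monoid.CoprodI.ext_hom _ _ fun b => ?_
      match b with
      | false => rfl
      | true => rfl)


theorem mixedEquiv_inl (G : Type*) [Group G] :
    mixedEquiv G (Monoid.Coprod.inl (Multiplicative.ofAdd 1)) =
      Monoid.CoprodI.of (MixedFactor.gen G) := rfl

theorem mixedEquiv_inr {G : Type*} [Group G] (g : G) :
    mixedEquiv G (Monoid.Coprod.inr g) = Monoid.CoprodI.of (M := MixedFactor G) (i := true) g := rfl

theorem mixedEval_inl {G : Type*} [Group G] (g : G) :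
    mixedEval g (Monoid.Coprod.inl (Multiplicative.ofAdd 1)) = g := by
  simp [mixedEval]

theorem mixedEval_inr {G : Type*} [Group G] (g h : G) :
    mixedEval g (Monoid.Coprod.inr h) = h := by
  simp [mixedEval]

theorem IsMIF.nontrivial {G : Type*} [Group G] (hG : IsMIF G) : Nontrivial G := by
  by_contra h
  rw [not_nontrivial_iff_subsingleton] at h
  have h1 := hG (Monoid.Coprod.inl (Multiplicative.ofAdd 1)) fun g => Subsingleton.elim _ _
  rw [map_eq_one_iff _ Monoid.Coprod.inl_injective] at h1
  exact one_ne_zero (congrArg (Multiplicative.toAdd (α := ℤ)) h1)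

/-- Finitely many non-trivial words over a non-trivial group are dominated by a single one: a
substitution that does not kill the latter does not kill any of the former. -/
theorem exists_word_dominating {G : Type*} [Group G] [Nontrivial G]
    (F : Finset (Monoid.Coprod (Multiplicative ℤ) G)) (hF : ∀ w ∈ F, w ≠ 1) :
    ∃ w : Monoid.Coprod (Multiplicative ℤ) G, w ≠ 1 ∧
      ∀ g : G, mixedEval g w ≠ 1 → ∀ v ∈ F, mixedEval g v ≠ 1 := by
  classical
  induction F using Finset.induction_on with
  | empty =>
    obtain ⟨s, hs⟩ := exists_ne (1 : G)
    exact ⟨Monoid.Coprod.inr s, by rwa [Ne, map_eq_one_iff _ Monoid.Coprod.inr_injective],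
      by simp⟩
  | insert a F _ ih =>
    obtain ⟨w, hw, hwF⟩ := ih fun v hv => hF v (Finset.mem_insert_of_mem hv)
    have ha : mixedEquiv G a ≠ 1 := by
      rw [Ne, map_eq_one_iff _ (mixedEquiv G).injective]
      exact hF a (Finset.mem_insert_self a F)
    have hw' : mixedEquiv G w ≠ 1 := by rwa [Ne, map_eq_one_iff _ (mixedEquiv G).injective]
    obtain ⟨y, z, hyz⟩ := Monoid.CoprodI.exists_not_commute_conj ha hw'
    obtain ⟨y, rfl⟩ := (mixedEquiv G).surjective y
    obtain ⟨z, rfl⟩ := (mixedEquiv G).surjective z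
    -- The commutator of the two conjugates dies as soon as `a` or `w` does.
    refine ⟨(y * a * y⁻¹) * (z * w * z⁻¹) * (y * a * y⁻¹)⁻¹ * (z * w * z⁻¹)⁻¹, ?_,
      fun g hg v hv => ?_⟩
    · intro h
      rw [mul_inv_eq_one, mul_inv_eq_iff_eq_mul] at h
      refine hyz ?_
      replace h : Commute (y * a * y⁻¹) (z * w * z⁻¹) := h
      simpa using h.map (mixedEquiv G)
    · simp only [map_mul, map_inv] at hg
      rcases Finset.mem_insert.1 hv with rfl | hv
      · intro h
        simp [h] at hg
      · refine hwF g (fun h => ?_) v hv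
        simp [h] at hg

/-- In a mixed-identity-free group, finitely many elements `a, b, c, d ≠ 1` can be put in
general position by a single `g`: conjugation by `g` makes them behave as if `g` were free from
them. -/
theorem IsMIF.exists_alternating_ne_one {G : Type*} [Group G] (hG : IsMIF G) (T : Finset G) :
    ∃ g : G, ∀ a ∈ T, ∀ b ∈ T, ∀ c ∈ T, ∀ d ∈ T, a ≠ 1 → b ≠ 1 → c ≠ 1 → d ≠ 1 →
      a * (g * b * g⁻¹) * c * (g * d * g⁻¹) ≠ 1 := by
  classical
  have := hG.nontrivial
  let t : Monoid.Coprod (Multiplicative ℤ) G := Monoid.Coprod.inl (Multiplicative.ofAdd 1)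
  let f : G → Monoid.Coprod (Multiplicative ℤ) G := Monoid.Coprod.inr
  let word : G × G × G × G → Monoid.Coprod (Multiplicative ℤ) G := fun p =>
    f p.1 * (t * f p.2.1 * t⁻¹) * f p.2.2.1 * (t * f p.2.2.2 * t⁻¹)
  let N := T.filter (· ≠ 1)
  obtain ⟨w, hw, hwF⟩ := exists_word_dominating ((N ×ˢ N ×ˢ N ×ˢ N).image word) (by
    simp only [Finset.mem_image, Finset.mem_product, N, Finset.mem_filter]
    rintro _ ⟨⟨a, b, c, d⟩, ⟨⟨-, ha⟩, ⟨-, hb⟩, ⟨-, hc⟩, -, hd⟩, rfl⟩ h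
    let L : ∀ x : MixedFactor G true, x ≠ 1 → Monoid.CoprodI.NeWord (MixedFactor G) true true :=
      fun x hx => .singleton x hx
    let τ : Monoid.CoprodI.NeWord (MixedFactor G) false false :=
      .singleton _ (MixedFactor.gen_ne_one G)
    let C : ∀ x : MixedFactor G true, x ≠ 1 → Monoid.CoprodI.NeWord (MixedFactor G) false false :=
      fun x hx => .append (.append τ (by decide) (L x hx)) (by decide) τ.inv
    refine Monoid.CoprodI.NeWord.prod_ne_one
      (.append (.append (.append (L a ha) (by decide) (C b hb)) (by decide) (L c hc)) (by decide)
        (C d hd)) ?_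
    have := congrArg (mixedEquiv G) h
    simp only [word, t, f, map_mul, map_inv, map_one, mixedEquiv_inl, mixedEquiv_inr] at this
    simp only [C, τ, Monoid.CoprodI.NeWord.append_prod, Monoid.CoprodI.NeWord.inv_prod,
      Monoid.CoprodI.NeWord.prod_singleton]
    exact this)
  obtain ⟨g, hg⟩ : ∃ g, mixedEval g w ≠ 1 := by
    by_contra! h
    exact hw (hG w h)
  refine ⟨g, fun a ha b hb c hc d hd ha1 hb1 hc1 hd1 => ?_⟩
  have := hwF g hg (word (a, b, c, d)) (Finset.mem_image_of_mem _ (by simp [N, *]))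
  simpa only [word, t, f, map_mul, map_inv, mixedEval_inl, mixedEval_inr] using this

/-- In a mixed-identity-free group, every finite set `B` has a conjugator `g` for which the
equation `h · (g k g⁻¹) = (g h' g⁻¹) · k'` holds in `B` only where it has to hold. -/
theorem IsMIF.exists_forall_mul_conj_eq_iff {G : Type*} [Group G] (hG : IsMIF G) (B : Finset G) :
    ∃ g : G, ∀ h ∈ B, ∀ k ∈ B, ∀ h' ∈ B, ∀ k' ∈ B,
      (g * h' * g⁻¹ * k' = h * (g * k * g⁻¹) ↔
        (k = 1 ∧ h' = 1 ∧ h = k') ∨ (h = 1 ∧ k' = 1 ∧ k = h')) := by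
  classical
  let U : Finset G := B ∪ B.image (·⁻¹) ∪ {1}
  let T : Finset G := (U ×ˢ U).image fun p => p.1 * p.2
  have hmul : ∀ {x y}, x ∈ U → y ∈ U → x * y ∈ T := fun hx hy =>
    Finset.mem_image.2 ⟨(_, _), Finset.mem_product.2 ⟨hx, hy⟩, rfl⟩
  have hU : ∀ {x}, x ∈ B → x ∈ U := fun hx => by simp [U, hx]
  have hUinv : ∀ {x}, x ∈ B → x⁻¹ ∈ U := fun hx => by simp [U, hx]
  have h1U : (1 : G) ∈ U := by simp [U]
  have hUT : ∀ {x}, x ∈ U → x ∈ T := fun hx => by simpa using hmul hx h1U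
  obtain ⟨g, hg⟩ := hG.exists_alternating_ne_one T
  -- The square of `x (g y g⁻¹)` is an alternating product, hence so restricted is `x (g y g⁻¹)`.
  have hg2 : ∀ {x y}, x ∈ T → y ∈ T → x * (g * y * g⁻¹) = 1 → x = 1 ∧ y = 1 := by
    intro x y hx hy h
    by_cases hx1 : x = 1
    · subst hx1
      simpa [mul_inv_eq_one] using h
    · by_cases hy1 : y = 1
      · subst hy1
        simpa using h
      · exact absurd (by rw [h, one_mul, h]) (hg x hx y hy x hx y hy hx1 hy1 hx1 hy1)
  refine ⟨g, fun h hh k hk h' hh' k' hk' => ⟨fun heq => ?_, ?_⟩⟩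
  · by_cases hk1 : k = 1
    · subst hk1
      obtain ⟨e1, e2⟩ := hg2 (hmul (hU hh) (hUinv hk')) (hUT (hUinv hh')) (by
        rw [← mul_inv_eq_one] at heq
        rw [← inv_eq_one, ← heq]; group)
      exact .inl ⟨rfl, inv_eq_one.1 e2, mul_inv_eq_one.1 e1⟩
    by_cases hh'1 : h' = 1
    · subst hh'1
      obtain ⟨e1, e2⟩ := hg2 (hmul (hUinv hk') (hU hh)) (hUT (hU hk)) (by
        rw [mul_assoc, ← heq]; group)
      exact absurd e2 hk1
    by_cases hh1 : h = 1
    · subst hh1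
      obtain ⟨e1, e2⟩ := hg2 (hUT (hUinv hk')) (hmul (hUinv hh') (hU hk)) (by
        rw [one_mul] at heq
        calc _ = k'⁻¹ * (g * h'⁻¹ * g⁻¹) * (g * k * g⁻¹) := by group
          _ = 1 := by rw [← heq]; group)
      exact .inr ⟨rfl, inv_eq_one.1 e1, (inv_mul_eq_one.1 e2).symm⟩
    by_cases hk'1 : k' = 1
    · subst hk'1
      obtain ⟨e1, e2⟩ := hg2 (hUT (hU hh)) (hmul (hU hk) (hUinv hh')) (by
        rw [mul_one] at heq
        calc _ = h * (g * k * g⁻¹) * (g * h' * g⁻¹)⁻¹ := by group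
          _ = 1 := by rw [← heq, mul_inv_cancel])
      exact absurd e1 hh1
    refine absurd ?_ (hg h (hUT (hU hh)) k (hUT (hU hk)) k'⁻¹ (hUT (hUinv hk')) h'⁻¹
      (hUT (hUinv hh')) hh1 hk1 (inv_ne_one.2 hk'1) (inv_ne_one.2 hh'1))
    rw [← heq]
    group
  · rintro (⟨rfl, rfl, rfl⟩ | ⟨rfl, rfl, rfl⟩) <;> group

/-! ### Fourier coefficients and the `2`-norm -/

/-- The embedding `x ↦ x δ₁` of `LG` into `ℓ²(G)`, which is isometric for the `2`-norm. -/
noncomputable def GroupVN.vec {G : Type*} [Group G] : GroupVN G →ₗ[ℂ] EllTwo G where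
  toFun x := (x : EllTwo G →L[ℂ] EllTwo G) (deltaOne G)
  map_add' _ _ := rfl
  map_smul' _ _ := rfl

/-- The Fourier coefficient of `x ∈ LG` at a group element. -/
noncomputable def GroupVN.coeff {G : Type*} [Group G] (x : GroupVN G) (h : G) : ℂ :=
  GroupVN.vec x h

theorem GroupVN.norm_vec {G : Type*} [Group G] (x : GroupVN G) : ‖GroupVN.vec x‖ = twoNorm x :=
  (twoNorm_eq x).symm

/-- The element `λ_g` of `LG`. -/
noncomputable def GroupVN.lam {G : Type*} [Group G] (g : G) : GroupVN G :=
  (leftRegularUnitary G g : UnitaryVN G)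

namespace GroupVN

variable {G : Type*} [Group G]

theorem lam_mul (g h : G) : lam (g * h) = lam g * lam h := by
  simp [lam]

theorem lam_one : lam (1 : G) = 1 := by
  simp [lam]

theorem coeff_lam (g h : G) : coeff (lam g) h = deltaOne G (g⁻¹ * h) := rfl

open Classical in
theorem vec_lam (g : G) : vec (lam g) = lp.single 2 g (1 : ℂ) := by
  ext h
  refine (coeff_lam g h).trans ?_
  by_cases hh : h = g
  · subst hh
    rw [inv_mul_cancel, deltaOne_apply_one, lp.single_apply_self]
  · rw [lp.single_apply_ne _ _ _ hh, deltaOne_apply_ne]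
    rwa [Ne, inv_mul_eq_one, eq_comm]

open Classical in
theorem inner_vec_lam (g h : G) : ⟪vec (lam g), vec (lam h)⟫_ℂ = if g = h then 1 else 0 := by
  rw [vec_lam, lp.inner_single_left]
  change ⟪(1 : ℂ), coeff (lam h) g⟫_ℂ = _
  rw [coeff_lam]
  split_ifs with hgh
  · subst hgh
    simp [deltaOne_apply_one]
  · rw [deltaOne_apply_ne]
    · simp
    · rw [Ne, inv_mul_eq_one]
      exact fun h => hgh h.symm

theorem norm_vec_unitary_mul (u : UnitaryVN G) (x : GroupVN G) :
    ‖vec ((u : GroupVN G) * x)‖ = ‖vec x‖ := by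
  rw [norm_vec, norm_vec, twoNorm_unitary_mul]

theorem norm_vec_lam_mul (g : G) (x : GroupVN G) : ‖vec (lam g * x)‖ = ‖vec x‖ :=
  norm_vec_unitary_mul _ x

theorem norm_vec_one : ‖vec (1 : GroupVN G)‖ = 1 := by
  classical
  rw [← lam_one, vec_lam, lp.norm_single (by norm_num)]
  simp

theorem norm_vec_unitary (u : UnitaryVN G) : ‖vec (u : GroupVN G)‖ = 1 := by
  rw [← mul_one (u : GroupVN G), norm_vec_unitary_mul, norm_vec_one]

/-- The `2`-norm is invariant under right translation by group elements: on `δ₁` these agree with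
operators of the right-regular representation, which commute with `LG`. -/
theorem norm_vec_mul_lam (x : GroupVN G) (g : G) : ‖vec (x * lam g)‖ = ‖vec x‖ := by
  let R : EllTwo G →ₗᵢ[ℂ] EllTwo G := EllTwo.permute (Equiv.mulRight g⁻¹)
  have hR : R.toContinuousLinearMap ∈
      StarSubalgebra.centralizer ℂ (Set.range (leftRegular (G := G))) := by
    have key : ∀ k : G, leftRegular k * R.toContinuousLinearMap =
        R.toContinuousLinearMap * leftRegular k := by
      intro k
      ext f h
      change f (k⁻¹ * h * g⁻¹) = f (k⁻¹ * (h * g⁻¹))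
      rw [mul_assoc]
    rw [StarSubalgebra.mem_centralizer_iff]
    rintro _ ⟨k, rfl⟩
    refine ⟨key k, ?_⟩
    rw [star_leftRegular]
    exact key _
  have hcomm := ((StarSubalgebra.mem_centralizer_iff ℂ).1 x.2 _ hR).1
  have hlam : vec (lam g) = R (deltaOne G) := by
    ext h
    refine (coeff_lam g h).trans ?_
    change _ = deltaOne G (h * g⁻¹)
    by_cases hh : h = g
    · simp [hh]
    · rw [deltaOne_apply_ne, deltaOne_apply_ne]
      · rwa [Ne, mul_inv_eq_one]
      · rwa [Ne, inv_mul_eq_one, eq_comm]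
  have h1 : vec (x * lam g) = R (vec x) := by
    change (x : EllTwo G →L[ℂ] EllTwo G) (vec (lam g)) = _
    rw [hlam]
    exact (congrArg (fun T : EllTwo G →L[ℂ] EllTwo G => T (deltaOne G)) hcomm).symm
  rw [h1, R.norm_map]

theorem norm_vec_mul_sum_le (x : GroupVN G) (S : Finset G) (c : G → ℂ) (f : G → G) :
    ‖vec (x * ∑ k ∈ S, c k • lam (f k))‖ ≤ (∑ k ∈ S, ‖c k‖) * ‖vec x‖ := by
  rw [Finset.mul_sum, map_sum, Finset.sum_mul]
  refine (norm_sum_le _ _).trans (Finset.sum_le_sum fun k _ => ?_)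
  rw [mul_smul_comm, map_smul, norm_smul, norm_vec_mul_lam]

/-- The Fourier series of `x ∈ LG` cut down to a finite set of group elements. -/
noncomputable def trunc (x : GroupVN G) (S : Finset G) : GroupVN G :=
  ∑ h ∈ S, coeff x h • lam h

theorem tendsto_vec_trunc (x : GroupVN G) :
    Filter.Tendsto (fun S => vec (trunc x S)) Filter.atTop (nhds (vec x)) := by
  classical
  have hs := lp.hasSum_single (by norm_num : (2 : ENNReal) ≠ ⊤) (vec x)
  refine (hs : Filter.Tendsto _ _ _).congr fun S => ?_
  rw [trunc, map_sum]
  refine Finset.sum_congr rfl fun h _ => ?_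
  rw [map_smul, vec_lam, ← lp.single_smul, smul_eq_mul, mul_one]
  rfl

theorem tendsto_sum_conj_mul_self (u : UnitaryVN G) :
    Filter.Tendsto (fun S : Finset G => ∑ h ∈ S, conj (coeff (u : GroupVN G) h) * coeff u h)
      Filter.atTop (nhds 1) := by
  have h := lp.hasSum_inner (𝕜 := ℂ) (vec (u : GroupVN G)) (vec (u : GroupVN G))
  rw [inner_self_eq_norm_sq_to_K, norm_vec_unitary] at h
  have h2 : ∀ z : ℂ, ⟪z, z⟫_ℂ = conj z * z := fun z => by
    rw [RCLike.inner_apply, mul_comm]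
  simp only [h2] at h
  simpa [HasSum, coeff] using h

open Classical in
/-- Inclusion-exclusion over the two families of solutions `(h, k, h', k')`, which meet in
`(1, 1, 1, 1)`. -/
theorem sum_ite_eq_of_free (ξ : G → ℂ) {A B : Finset G} (hAB : A ⊆ B) (h1 : 1 ∈ A) :
    (∑ h ∈ B, ∑ k ∈ A, ∑ h' ∈ B, ∑ k' ∈ A,
      if (k = 1 ∧ h' = 1 ∧ h = k') ∨ (h = 1 ∧ k' = 1 ∧ k = h') then
        conj (ξ h') * conj (ξ k') * (ξ h * ξ k) else 0) =
      2 * (conj (ξ 1) * ξ 1) * (∑ k ∈ A, conj (ξ k) * ξ k) - (conj (ξ 1) * ξ 1) ^ 2 := by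
  have h1B : 1 ∈ B := hAB h1
  have hsplit : ∀ h k h' k' : G, ∀ z : ℂ,
      (if (k = 1 ∧ h' = 1 ∧ h = k') ∨ (h = 1 ∧ k' = 1 ∧ k = h') then z else 0) =
        (if k = 1 then if h' = 1 then if h = k' then z else 0 else 0 else 0) +
        (if h = 1 then if k' = 1 then if k = h' then z else 0 else 0 else 0) -
        (if h = 1 then if k = 1 then if h' = 1 then if k' = 1 then z else 0 else 0 else 0
          else 0) := by
    intro h k h' k' z
    have hboth : (h = 1 ∧ k = 1 ∧ h' = 1 ∧ k' = 1) ↔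
        (k = 1 ∧ h' = 1 ∧ h = k') ∧ (h = 1 ∧ k' = 1 ∧ k = h') := by grind
    simp only [← ite_and, hboth]
    by_cases hP : k = 1 ∧ h' = 1 ∧ h = k' <;> by_cases hQ : h = 1 ∧ k' = 1 ∧ k = h' <;>
      simp only [hP, hQ, true_or, or_true, or_self, and_self, and_true, true_and,
        if_true, if_false] <;> ring
  have hP : (∑ h ∈ B, ∑ k ∈ A, ∑ h' ∈ B, ∑ k' ∈ A,
      if k = 1 then if h' = 1 then if h = k' then
        conj (ξ h') * conj (ξ k') * (ξ h * ξ k) else 0 else 0 else 0) =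
      (conj (ξ 1) * ξ 1) * (∑ k ∈ A, conj (ξ k) * ξ k) := by
    calc _ = ∑ h ∈ B, if h ∈ A then conj (ξ 1) * conj (ξ h) * (ξ h * ξ 1) else 0 := by
          refine Finset.sum_congr rfl fun h _ => ?_
          rw [Finset.sum_eq_single_of_mem 1 h1 fun k _ hk => by simp [hk],
            Finset.sum_eq_single_of_mem 1 h1B fun k _ hk => by simp [hk]]
          simp
      _ = ∑ h ∈ A, conj (ξ 1) * conj (ξ h) * (ξ h * ξ 1) := by
          rw [← Finset.sum_filter, Finset.filter_mem_eq_inter, Finset.inter_eq_right.2 hAB]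
      _ = _ := by
          rw [Finset.mul_sum]
          exact Finset.sum_congr rfl fun h _ => by ring
  have hQ : (∑ h ∈ B, ∑ k ∈ A, ∑ h' ∈ B, ∑ k' ∈ A,
      if h = 1 then if k' = 1 then if k = h' then
        conj (ξ h') * conj (ξ k') * (ξ h * ξ k) else 0 else 0 else 0) =
      (conj (ξ 1) * ξ 1) * (∑ k ∈ A, conj (ξ k) * ξ k) := by
    rw [Finset.sum_eq_single_of_mem 1 h1B fun k _ hk => by simp [hk], Finset.mul_sum]
    refine Finset.sum_congr rfl fun k hk => ?_
    rw [Finset.sum_eq_single_of_mem k (hAB hk) fun h' _ hh' => by simp [hh'.symm],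
      Finset.sum_eq_single_of_mem 1 h1 fun k _ hk => by simp [hk]]
    simp only [if_true]
    ring
  have hPQ : (∑ h ∈ B, ∑ k ∈ A, ∑ h' ∈ B, ∑ k' ∈ A,
      if h = 1 then if k = 1 then if h' = 1 then if k' = 1 then
        conj (ξ h') * conj (ξ k') * (ξ h * ξ k) else 0 else 0 else 0 else 0) =
      (conj (ξ 1) * ξ 1) ^ 2 := by
    rw [Finset.sum_eq_single_of_mem 1 h1B fun k _ hk => by simp [hk],
      Finset.sum_eq_single_of_mem 1 h1 fun k _ hk => by simp [hk],
      Finset.sum_eq_single_of_mem 1 h1B fun k _ hk => by simp [hk],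
      Finset.sum_eq_single_of_mem 1 h1 fun k _ hk => by simp [hk]]
    simp only [if_true]
    ring
  simp only [hsplit, Finset.sum_sub_distrib, Finset.sum_add_distrib, hP, hQ, hPQ]
  ring

open Classical in
/-- For an orthonormal family `v` indexed by `G`, only the solutions of the equation in `B`
described by `hg` contribute to the inner product. -/
theorem inner_sum_sum_of_free {E : Type*} [NormedAddCommGroup E] [InnerProductSpace ℂ E]
    {v : G → E} (hv : ∀ g h, ⟪v g, v h⟫_ℂ = if g = h then 1 else 0) (ξ : G → ℂ)
    {A B : Finset G} (hAB : A ⊆ B) (h1 : 1 ∈ A) {g : G}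
    (hg : ∀ h ∈ B, ∀ k ∈ B, ∀ h' ∈ B, ∀ k' ∈ B,
      (g * h' * g⁻¹ * k' = h * (g * k * g⁻¹) ↔
        (k = 1 ∧ h' = 1 ∧ h = k') ∨ (h = 1 ∧ k' = 1 ∧ k = h'))) :
    ⟪∑ h' ∈ B, ∑ k' ∈ A, (ξ h' * ξ k') • v (g * h' * g⁻¹ * k'),
        ∑ h ∈ B, ∑ k ∈ A, (ξ h * ξ k) • v (h * (g * k * g⁻¹))⟫_ℂ =
      2 * (conj (ξ 1) * ξ 1) * (∑ k ∈ A, conj (ξ k) * ξ k) - (conj (ξ 1) * ξ 1) ^ 2 := by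
  rw [← sum_ite_eq_of_free ξ hAB h1]
  simp only [inner_sum, sum_inner, inner_smul_left, inner_smul_right, hv, map_mul,
    Finset.mul_sum]
  refine Finset.sum_congr rfl fun h hh => Finset.sum_congr rfl fun k hk =>
    Finset.sum_congr rfl fun h' hh' => Finset.sum_congr rfl fun k' hk' => ?_
  simp only [hg h hh k (hAB hk) h' hh' k' (hAB hk'), mul_ite, mul_one, mul_zero]
  split_ifs <;> ring

/-- If `g` is in general position to `B ⊇ A`, the inner product of the two products of a
truncation and a conjugated truncation is what freeness predicts. -/
theorem inner_conj_trunc_mul {x : GroupVN G} {A B : Finset G} (hAB : A ⊆ B) (h1 : 1 ∈ A) {g : G}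
    (hg : ∀ h ∈ B, ∀ k ∈ B, ∀ h' ∈ B, ∀ k' ∈ B,
      (g * h' * g⁻¹ * k' = h * (g * k * g⁻¹) ↔
        (k = 1 ∧ h' = 1 ∧ h = k') ∨ (h = 1 ∧ k' = 1 ∧ k = h'))) :
    ⟪vec (lam g * trunc x B * lam g⁻¹ * trunc x A),
        vec (trunc x B * (lam g * trunc x A * lam g⁻¹))⟫_ℂ =
      2 * (conj (coeff x 1) * coeff x 1) * (∑ k ∈ A, conj (coeff x k) * coeff x k) -
        (conj (coeff x 1) * coeff x 1) ^ 2 := by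
  have hX : vec (lam g * trunc x B * lam g⁻¹ * trunc x A) =
      ∑ h' ∈ B, ∑ k' ∈ A, (coeff x h' * coeff x k') • vec (lam (g * h' * g⁻¹ * k')) := by
    simp only [trunc, Finset.mul_sum, Finset.sum_mul, map_sum, mul_smul_comm, smul_mul_assoc,
      map_smul, lam_mul, mul_assoc, Finset.smul_sum]
    rw [Finset.sum_comm]
    simp only [smul_smul, mul_comm]
  have hY : vec (trunc x B * (lam g * trunc x A * lam g⁻¹)) =
      ∑ h ∈ B, ∑ k ∈ A, (coeff x h * coeff x k) • vec (lam (h * (g * k * g⁻¹))) := by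
    simp only [trunc, Finset.mul_sum, Finset.sum_mul, map_sum, mul_smul_comm, smul_mul_assoc,
      map_smul, lam_mul, mul_assoc, Finset.smul_sum]
    rw [Finset.sum_comm]
    simp only [smul_smul, mul_comm]
  rw [hX, hY]
  exact inner_sum_sum_of_free inner_vec_lam (fun h => coeff x h) hAB h1 hg

/-! ### The trace of a commutator -/

theorem inner_vec_unitary_mul (u : UnitaryVN G) (x y : GroupVN G) :
    ⟪vec ((u : GroupVN G) * x), vec ((u : GroupVN G) * y)⟫_ℂ = ⟪vec x, vec y⟫_ℂ := by
  let U : EllTwo G →ₗᵢ[ℂ] EllTwo G :=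
    { toLinearMap := ((u : GroupVN G) : EllTwo G →L[ℂ] EllTwo G).toLinearMap
      norm_map' := norm_unitaryVN_apply u }
  exact U.inner_map_map (vec x) (vec y)

theorem inner_vec_one (x : GroupVN G) : ⟪vec 1, vec x⟫_ℂ = coeff x 1 := by
  classical
  rw [← lam_one, vec_lam, lp.inner_single_left]
  change ⟪(1 : ℂ), coeff x 1⟫_ℂ = _
  rw [RCLike.inner_apply]
  simp

theorem norm_coeff_one_le (u : UnitaryVN G) : ‖coeff (u : GroupVN G) 1‖ ≤ 1 := by
  rw [← inner_vec_one]
  refine (norm_inner_le_norm _ _).trans_eq ?_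
  rw [norm_vec_one, norm_vec_unitary, mul_one]

theorem projLength_sq (u : UnitaryVN G) :
    projLength u ^ 2 = 2 - 2 * ‖coeff (u : GroupVN G) 1‖ := by
  have key : ∀ c : Circle, twoNorm ((c : ℂ) • 1 - (u : GroupVN G)) ^ 2 =
      2 - 2 * (conj (c : ℂ) * coeff (u : GroupVN G) 1).re := by
    intro c
    have h : RCLike.re ⟪(c : ℂ) • vec (1 : GroupVN G), vec (u : GroupVN G)⟫_ℂ =
        (conj (c : ℂ) * coeff (u : GroupVN G) 1).re := by
      rw [inner_smul_left, inner_vec_one]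
      rfl
    rw [← norm_vec, map_sub, map_smul, norm_sub_sq (𝕜 := ℂ), h, norm_smul, norm_vec_one,
      norm_vec_unitary, Circle.norm_coe]
    ring
  refine le_antisymm ?_ ?_
  · -- The phase of the trace is the optimal scalar.
    set z := coeff (u : GroupVN G) 1 with hz
    have h := key (Circle.exp z.arg)
    have hre : (conj (Circle.exp z.arg : ℂ) * z).re = ‖z‖ := by
      have he : conj (Circle.exp z.arg : ℂ) * z = ‖z‖ := by
        calc conj (Circle.exp z.arg : ℂ) * z
            = conj (Circle.exp z.arg : ℂ) * (‖z‖ * (Circle.exp z.arg : ℂ)) := by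
              rw [Circle.coe_exp, Complex.norm_mul_exp_arg_mul_I]
          _ = ‖z‖ := by
              rw [mul_left_comm, Complex.conj_mul', Circle.norm_coe]
              simp
      rw [he, Complex.ofReal_re]
    rw [hre] at h
    rw [← h]
    exact pow_le_pow_left₀ (Real.iInf_nonneg fun _ => Real.sqrt_nonneg _) (projLength_le u _) 2
  · obtain ⟨c, hc⟩ := exists_projLength_eq u
    rw [hc, key]
    have := Complex.re_le_norm (conj (c : ℂ) * coeff (u : GroupVN G) 1)
    rw [norm_mul, Complex.norm_conj, Circle.norm_coe, one_mul] at this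
    linarith

theorem conj_mul_sub_conj_mul {R : Type*} [Ring R] (p q u a b : R) :
    p * u * q * u - p * b * q * a = p * u * q * (u - a) + p * ((u - b) * (q * a)) := by
  noncomm_ring

theorem mul_conj_sub_mul_conj {R : Type*} [Ring R] (p q u a b : R) :
    u * (p * u * q) - b * (p * a * q) = u * (p * ((u - a) * q)) + (u - b) * (p * a * q) := by
  noncomm_ring

/-- Truncating both factors in `(λ_g u λ_g⁻¹) u`, the right one first. -/
theorem norm_vec_conj_mul_sub_le (u : UnitaryVN G) (A B : Finset G) (g : G) :
    ‖vec (lam g * (u : GroupVN G) * lam g⁻¹ * (u : GroupVN G)) -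
        vec (lam g * trunc (u : GroupVN G) B * lam g⁻¹ * trunc (u : GroupVN G) A)‖ ≤
      ‖vec ((u : GroupVN G) - trunc u A)‖ +
        (∑ k ∈ A, ‖coeff (u : GroupVN G) k‖) * ‖vec ((u : GroupVN G) - trunc u B)‖ := by
  have h2 : lam g⁻¹ * trunc (u : GroupVN G) A =
      ∑ k ∈ A, coeff (u : GroupVN G) k • lam (g⁻¹ * k) := by
    simp only [trunc, Finset.mul_sum, mul_smul_comm, lam_mul]
  have h3 := norm_vec_mul_sum_le ((u : GroupVN G) - trunc u B) A (coeff (u : GroupVN G))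
    fun k => g⁻¹ * k
  rw [← map_sub, conj_mul_sub_conj_mul, map_add]
  refine (norm_add_le _ _).trans (add_le_add (le_of_eq ?_) ?_)
  · rw [mul_assoc, mul_assoc, norm_vec_lam_mul, norm_vec_unitary_mul, norm_vec_lam_mul]
  · rwa [norm_vec_lam_mul, h2]

/-- Truncating both factors in `u (λ_g u λ_g⁻¹)`, the right one first. -/
theorem norm_vec_mul_conj_sub_le (u : UnitaryVN G) (A B : Finset G) (g : G) :
    ‖vec ((u : GroupVN G) * (lam g * (u : GroupVN G) * lam g⁻¹)) -
        vec (trunc (u : GroupVN G) B * (lam g * trunc (u : GroupVN G) A * lam g⁻¹))‖ ≤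
      ‖vec ((u : GroupVN G) - trunc u A)‖ +
        (∑ k ∈ A, ‖coeff (u : GroupVN G) k‖) * ‖vec ((u : GroupVN G) - trunc u B)‖ := by
  have h2 : lam g * trunc (u : GroupVN G) A * lam g⁻¹ =
      ∑ k ∈ A, coeff (u : GroupVN G) k • lam (g * k * g⁻¹) := by
    simp only [trunc, Finset.mul_sum, Finset.sum_mul, mul_smul_comm, smul_mul_assoc, lam_mul]
  have h3 := norm_vec_mul_sum_le ((u : GroupVN G) - trunc u B) A (coeff (u : GroupVN G))
    fun k => g * k * g⁻¹
  rw [← map_sub, mul_conj_sub_mul_conj, map_add]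
  refine (norm_add_le _ _).trans (add_le_add (le_of_eq ?_) ?_)
  · rw [norm_vec_unitary_mul, norm_vec_lam_mul, norm_vec_mul_lam]
  · rwa [h2]

theorem norm_inner_sub_inner_le {E : Type*} [NormedAddCommGroup E] [InnerProductSpace ℂ E]
    {x y x' y' : E} (hx : ‖x‖ = 1) (hy : ‖y‖ = 1) {r : ℝ} (hxx' : ‖x - x'‖ ≤ r)
    (hyy' : ‖y - y'‖ ≤ r) : ‖⟪x, y⟫_ℂ - ⟪x', y'⟫_ℂ‖ ≤ r + (1 + r) * r := by
  have hx' : ‖x'‖ ≤ 1 + r := by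
    have := norm_sub_norm_le x' x
    rw [norm_sub_rev] at this
    linarith
  have hr : 0 ≤ r := (norm_nonneg _).trans hxx'
  have h1 : ⟪x, y⟫_ℂ - ⟪x', y'⟫_ℂ = ⟪x - x', y⟫_ℂ + ⟪x', y - y'⟫_ℂ := by
    rw [inner_sub_left, inner_sub_right]
    ring
  have h2 := norm_inner_le_norm (𝕜 := ℂ) (x - x') y
  have h3 := norm_inner_le_norm (𝕜 := ℂ) x' (y - y')
  rw [hy, mul_one] at h2
  have h4 : ‖x'‖ * ‖y - y'‖ ≤ (1 + r) * r := by gcongr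
  rw [h1]
  refine (norm_add_le _ _).trans ?_
  linarith

theorem coeff_commutator_one (u v : UnitaryVN G) :
    coeff ((u⁻¹ * v⁻¹ * u * v : UnitaryVN G) : GroupVN G) 1 =
      ⟪vec ((v : GroupVN G) * (u : GroupVN G)), vec ((u : GroupVN G) * (v : GroupVN G))⟫_ℂ := by
  have h : v * u * (u⁻¹ * v⁻¹ * u * v) = u * v := by group
  rw [← inner_vec_one, ← inner_vec_unitary_mul (v * u), mul_one, ← Submonoid.coe_mul, h]
  rfl

/-- The second truncation `B` is chosen after the first one `A`, since it has to beat the operator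
norm of the latter, which is bounded by an `ℓ¹`-norm. -/
theorem exists_trunc_approx (u : UnitaryVN G) {δ : ℝ} (hδ : 0 < δ) :
    ∃ A B : Finset G, 1 ∈ A ∧ A ⊆ B ∧
      ‖(∑ k ∈ A, conj (coeff (u : GroupVN G) k) * coeff (u : GroupVN G) k) - 1‖ ≤ δ ∧
      ‖vec ((u : GroupVN G) - trunc u A)‖ +
        (∑ k ∈ A, ‖coeff (u : GroupVN G) k‖) * ‖vec ((u : GroupVN G) - trunc u B)‖ ≤ 2 * δ := by
  have hev : ∀ η : ℝ, 0 < η → ∀ᶠ S in Filter.atTop,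
      ‖vec ((u : GroupVN G) - trunc u S)‖ < η := by
    intro η hη
    filter_upwards [Metric.tendsto_nhds.1 (tendsto_vec_trunc (u : GroupVN G)) η hη] with S hS
    rwa [map_sub, ← dist_eq_norm, dist_comm]
  obtain ⟨A, hA, hAsum, h1A⟩ := ((hev δ hδ).and ((Metric.tendsto_nhds.1
    (tendsto_sum_conj_mul_self u) δ hδ).and (Filter.eventually_ge_atTop {1}))).exists
  obtain ⟨K, hK⟩ : ∃ K : ℝ, K = ∑ k ∈ A, ‖coeff (u : GroupVN G) k‖ := ⟨_, rfl⟩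
  have hK0 : 0 ≤ K := hK ▸ Finset.sum_nonneg fun _ _ => norm_nonneg _
  obtain ⟨B, hB, hAB⟩ := ((hev (δ / (K + 1)) (by positivity)).and
    (Filter.eventually_ge_atTop A)).exists
  refine ⟨A, B, h1A (Finset.mem_singleton_self 1), hAB, (dist_eq_norm _ (1 : ℂ) ▸ hAsum.le), ?_⟩
  rw [← hK, two_mul]
  refine add_le_add hA.le ?_
  calc K * ‖vec ((u : GroupVN G) - trunc u B)‖ ≤ K * (δ / (K + 1)) := by gcongr
    _ ≤ (K + 1) * (δ / (K + 1)) := by gcongr; linarith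
    _ = δ := by field_simp

/-- Asymptotic freeness: conjugating a unitary `u` of `LG` by a suitable element of the
mixed-identity-free group `G` brings the trace of the commutator of `u` with its conjugate as close
as desired to its value `2 |τ(u)|² - |τ(u)|⁴` for free copies of `u`. -/
theorem exists_norm_coeff_commutator_sub_lt (hG : IsMIF G) (u : UnitaryVN G) {ε : ℝ} (hε : 0 < ε) :
    ∃ g : G, ‖coeff ((u⁻¹ * (leftRegularUnitary G g * u * (leftRegularUnitary G g)⁻¹)⁻¹ * u *
        (leftRegularUnitary G g * u * (leftRegularUnitary G g)⁻¹) : UnitaryVN G) : GroupVN G) 1 -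
      ((2 * ‖coeff (u : GroupVN G) 1‖ ^ 2 - ‖coeff (u : GroupVN G) 1‖ ^ 4 : ℝ) : ℂ)‖ < ε := by
  obtain ⟨δ, hδ, hδ1, hδε⟩ : ∃ δ : ℝ, 0 < δ ∧ δ ≤ 1 ∧ 10 * δ < ε := by
    refine ⟨min 1 (ε / 20), by positivity, min_le_left _ _, ?_⟩
    linarith [min_le_right 1 (ε / 20)]
  obtain ⟨A, B, h1A, hAB, hsum, happrox⟩ := exists_trunc_approx u hδ
  obtain ⟨g, hg⟩ := hG.exists_forall_mul_conj_eq_iff B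
  refine ⟨g, ?_⟩
  obtain ⟨v, hv⟩ : ∃ v : UnitaryVN G,
    v = leftRegularUnitary G g * u * (leftRegularUnitary G g)⁻¹ := ⟨_, rfl⟩
  have hvlam : (v : GroupVN G) = lam g * (u : GroupVN G) * lam g⁻¹ := by
    rw [hv, ← map_inv]
    rfl
  have hXX' := (norm_vec_conj_mul_sub_le u A B g).trans happrox
  have hYY' := (norm_vec_mul_conj_sub_le u A B g).trans happrox
  have hval := inner_conj_trunc_mul (x := (u : GroupVN G)) hAB h1A hg
  rw [← hvlam] at hXX' hYY'
  have hinner := norm_inner_sub_inner_le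
    ((norm_vec_unitary_mul v _).trans (norm_vec_unitary u))
    ((norm_vec_unitary_mul u _).trans (norm_vec_unitary v)) hXX' hYY'
  rw [← hv, coeff_commutator_one]
  rw [hval] at hinner
  clear hval hXX' hYY' happrox hvlam hv hg
  have hz : ‖coeff (u : GroupVN G) 1‖ ≤ 1 := norm_coeff_one_le u
  generalize ⟪vec ((v : GroupVN G) * (u : GroupVN G)),
    vec ((u : GroupVN G) * (v : GroupVN G))⟫_ℂ = t at hinner ⊢
  generalize (∑ k ∈ A, conj (coeff (u : GroupVN G) k) * coeff (u : GroupVN G) k) = s at hinner hsum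
  generalize coeff (u : GroupVN G) 1 = z at hinner hz ⊢
  have hlim : ‖2 * (conj z * z) * s - (conj z * z) ^ 2 - ((2 * ‖z‖ ^ 2 - ‖z‖ ^ 4 : ℝ) : ℂ)‖ ≤
      2 * δ := by
    have h1 : 2 * (conj z * z) * s - (conj z * z) ^ 2 - ((2 * ‖z‖ ^ 2 - ‖z‖ ^ 4 : ℝ) : ℂ) =
        2 * (‖z‖ : ℂ) ^ 2 * (s - 1) := by
      rw [Complex.conj_mul']
      push_cast
      ring
    have h3 : ‖z‖ ^ 2 ≤ 1 := pow_le_one₀ (norm_nonneg _) hz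
    rw [h1, norm_mul, norm_mul, norm_pow, Complex.norm_real, norm_norm, Complex.norm_ofNat]
    calc 2 * ‖z‖ ^ 2 * ‖s - 1‖ ≤ 2 * 1 * δ := by gcongr
      _ = 2 * δ := by ring
  refine (norm_sub_le_norm_sub_add_norm_sub _ _ _).trans_lt
    ((add_le_add hinner hlim).trans_lt ?_)
  nlinarith

end GroupVN

/-! ### Commutator contraction and the uniform gap -/

theorem projLength_nonneg {G : Type*} [Group G] (u : UnitaryVN G) : 0 ≤ projLength u :=
  Real.iInf_nonneg fun _ => Real.sqrt_nonneg _

/-- Commutators with a generic conjugate contract the projective length near the identity,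
without ever reaching the identity. -/
theorem exists_projLength_commutator_le {G : Type*} [Group G] (hG : IsMIF G) (u : UnitaryVN G)
    (h0 : 0 < projLength u) (h1 : projLength u < 1 / 4) :
    ∃ g : G, 0 < projLength (u⁻¹ * (leftRegularUnitary G g * u * (leftRegularUnitary G g)⁻¹)⁻¹ *
        u * (leftRegularUnitary G g * u * (leftRegularUnitary G g)⁻¹)) ∧
      projLength (u⁻¹ * (leftRegularUnitary G g * u * (leftRegularUnitary G g)⁻¹)⁻¹ *
        u * (leftRegularUnitary G g * u * (leftRegularUnitary G g)⁻¹)) ≤ projLength u / 2 := by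
  have hsq := GroupVN.projLength_sq u
  set p := ‖GroupVN.coeff (u : GroupVN G) 1‖ with hp
  have hp0 : 0 ≤ p := norm_nonneg _
  set l := projLength u with hl
  have hp1 : p < 1 := by nlinarith
  have hd : 0 < 1 - p ^ 2 := by nlinarith
  have hdl : 1 - p ^ 2 ≤ l ^ 2 := by nlinarith
  obtain ⟨g, hg⟩ := GroupVN.exists_norm_coeff_commutator_sub_lt hG u
    (ε := (1 - p ^ 2) ^ 2 / 2) (by positivity)
  refine ⟨g, ?_⟩
  set w := u⁻¹ * (leftRegularUnitary G g * u * (leftRegularUnitary G g)⁻¹)⁻¹ *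
        u * (leftRegularUnitary G g * u * (leftRegularUnitary G g)⁻¹) with hw
  have hwsq := GroupVN.projLength_sq w
  -- Free copies of `u` would give trace `1 - (1 - p ^ 2) ^ 2`.
  have habs := (abs_norm_sub_norm_le _ _).trans_lt hg
  rw [Complex.norm_real, Real.norm_of_nonneg (by nlinarith [pow_nonneg hp0 2]), abs_lt] at habs
  set q := ‖GroupVN.coeff (w : GroupVN G) 1‖
  have hlower : 0 < projLength w ^ 2 := by nlinarith [habs.2, pow_pos hd 2]
  have hd2 : (1 - p ^ 2) ^ 2 ≤ (l ^ 2) ^ 2 := pow_le_pow_left₀ hd.le hdl 2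
  have hl2 : l ^ 2 ≤ 1 / 16 := by nlinarith
  have hl4 : (l ^ 2) ^ 2 ≤ 1 / 16 * l ^ 2 := by nlinarith [sq_nonneg l]
  have hupper : projLength w ^ 2 ≤ (l / 2) ^ 2 := by nlinarith [habs.1]
  refine ⟨?_, (pow_le_pow_iff_left₀ (projLength_nonneg w) (by positivity) two_ne_zero).1 hupper⟩
  exact (projLength_nonneg w).lt_of_ne fun h => by simp [← h] at hlower

namespace ProjUnitaryVN

variable {G : Type*} [Group G]

theorem length_nonneg (x : ProjUnitaryVN G) : 0 ≤ x.length := by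
  obtain ⟨u, rfl⟩ := mk_surjective x
  exact projLength_nonneg u

theorem length_eq_zero_iff (x : ProjUnitaryVN G) : x.length = 0 ↔ x = 1 := by
  obtain ⟨u, rfl⟩ := mk_surjective x
  rw [length_mk, projLength_eq_zero_iff, mk_eq_one_iff]

theorem dist_one_left (x : ProjUnitaryVN G) : dist 1 x = x.length := by
  rw [dist_def, inv_one, one_mul]

theorem exists_length_le_half (hG : IsMIF G) {Δ : Subgroup (ProjUnitaryVN G)}
    (hΔ : (toProjUnitaryVN G).range ≤ Δ) {x : ProjUnitaryVN G} (hx : x ∈ Δ) (hx1 : x ≠ 1)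
    (hxs : x.length < 1 / 4) :
    ∃ y ∈ Δ, y ≠ 1 ∧ y.length ≤ x.length / 2 := by
  obtain ⟨u, rfl⟩ := mk_surjective x
  obtain ⟨g, hg0, hg⟩ := exists_projLength_commutator_le hG u
    ((length_nonneg _).lt_of_ne fun h => hx1 ((length_eq_zero_iff _).1 h.symm)) hxs
  refine ⟨mk G _, ?_, fun h => hg0.ne' ?_, hg⟩
  · have hgΔ : mk G (leftRegularUnitary G g) ∈ Δ := hΔ ⟨g, rfl⟩
    simp only [map_mul, map_inv]
    have hvΔ := Δ.mul_mem (Δ.mul_mem hgΔ hx) (Δ.inv_mem hgΔ)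
    exact Δ.mul_mem (Δ.mul_mem (Δ.mul_mem (Δ.inv_mem hx) (Δ.inv_mem hvΔ)) hx) hvΔ
  · rw [← length_mk, h, length_eq_zero_iff]

/-- The gap `1/4` is common to all discrete subgroups containing `G`; this uniformity is what
survives the passage to unions of chains. -/
theorem le_length_of_discrete (hG : IsMIF G) {Δ : Subgroup (ProjUnitaryVN G)}
    (hΔ : (toProjUnitaryVN G).range ≤ Δ) (hdisc : DiscreteTopology Δ) {x : ProjUnitaryVN G}
    (hx : x ∈ Δ) (hx1 : x ≠ 1) : 1 / 4 ≤ x.length := by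
  by_contra! hxs
  have hiter : ∀ n : ℕ, ∃ y ∈ Δ, y ≠ 1 ∧ y.length ≤ x.length / 2 ^ n := by
    intro n
    induction n with
    | zero => exact ⟨x, hx, hx1, by simp⟩
    | succ n ih =>
      obtain ⟨y, hy, hy1, hyn⟩ := ih
      have hle : x.length / 2 ^ n ≤ x.length :=
        div_le_self (length_nonneg x) (one_le_pow₀ one_le_two)
      obtain ⟨z, hz, hz1, hzy⟩ := exists_length_le_half hG hΔ hy hy1 (by linarith)
      refine ⟨z, hz, hz1, ?_⟩
      rw [pow_succ, ← div_div]
      linarith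
  obtain ⟨ε, hε, hball⟩ := Metric.isOpen_singleton_iff.1 (isOpen_discrete {(1 : Δ)})
  obtain ⟨n, hn⟩ := exists_pow_lt_of_lt_one hε (by norm_num : (1 / 2 : ℝ) < 1)
  obtain ⟨y, hy, hy1, hyn⟩ := hiter n
  refine hy1 (congrArg Subtype.val (hball ⟨y, hy⟩ ?_))
  rw [dist_comm]
  change dist 1 y < ε
  rw [dist_one_left]
  calc y.length ≤ x.length / 2 ^ n := hyn
    _ ≤ 1 / 2 ^ n := by gcongr; linarith
    _ = (1 / 2) ^ n := by rw [one_div_pow]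
    _ < ε := hn

theorem discreteTopology_of_le_length {Δ : Subgroup (ProjUnitaryVN G)} {r : ℝ} (hr : 0 < r)
    (h : ∀ x ∈ Δ, x ≠ 1 → r ≤ x.length) : DiscreteTopology Δ := by
  refine DiscreteTopology.of_forall_le_dist hr fun x y hxy => ?_
  change r ≤ dist (x : ProjUnitaryVN G) y
  rw [dist_def]
  refine h _ (Δ.mul_mem (Δ.inv_mem x.2) y.2) ?_
  rw [Ne, inv_mul_eq_one]
  exact fun h => hxy (Subtype.ext h)

/-- The trace of `λ_g` vanishes for `g ≠ 1`, so `λ_g` is as far from the scalars as possible. -/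
theorem length_toProjUnitaryVN {g : G} (hg : g ≠ 1) : (toProjUnitaryVN G g).length ^ 2 = 2 := by
  change projLength (leftRegularUnitary G g) ^ 2 = 2
  rw [GroupVN.projLength_sq]
  change 2 - 2 * ‖GroupVN.coeff (GroupVN.lam g) 1‖ = 2
  rw [GroupVN.coeff_lam, deltaOne_apply_ne (by simpa using hg)]
  simp

theorem discreteTopology_range : DiscreteTopology (toProjUnitaryVN G).range := by
  refine discreteTopology_of_le_length one_pos ?_
  rintro _ ⟨g, rfl⟩ hne
  have h := length_toProjUnitaryVN (G := G) (g := g) (by rintro rfl; exact hne (map_one _))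
  nlinarith [length_nonneg (toProjUnitaryVN G g)]

end ProjUnitaryVN

/-! ### Maximal discrete subgroups -/

theorem theorem3p5 (G : Type*) [Group G] (hG : IsMIF G) :
    ∃ Γ : Subgroup (ProjUnitaryVN G), (toProjUnitaryVN G).range ≤ Γ ∧
      Maximal (fun Δ : Subgroup (ProjUnitaryVN G) => DiscreteTopology Δ) Γ := by
  obtain ⟨Γ, hle, hΓ⟩ := zorn_le_nonempty₀
    {Δ : Subgroup (ProjUnitaryVN G) | (toProjUnitaryVN G).range ≤ Δ ∧ DiscreteTopology Δ}
    (by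
      intro c hc hchain Δ hΔ
      refine ⟨sSup c, ⟨(hc hΔ).1.trans (le_sSup hΔ), ?_⟩, fun _ h => le_sSup h⟩
      refine ProjUnitaryVN.discreteTopology_of_le_length (r := 1 / 4) (by norm_num)
        fun x hx hx1 => ?_
      obtain ⟨Δ', hΔ', hx'⟩ :=
        (Subgroup.mem_sSup_of_directedOn ⟨Δ, hΔ⟩ hchain.directedOn).1 hx
      exact ProjUnitaryVN.le_length_of_discrete hG (hc hΔ').1 (hc hΔ').2 hx' hx1)
    (toProjUnitaryVN G).range ⟨le_rfl, ProjUnitaryVN.discreteTopology_range⟩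
  exact ⟨Γ, hle, hΓ.prop.2, fun Δ hΔ hΓΔ => hΓ.le_of_ge ⟨hle.trans hΓΔ, hΔ⟩ hΓΔ⟩
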